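/- Let $K_1,\dots,K_m\subset\mathbb{R}^n$ be closed sets with intersection $K=\bigcap_{l=1}^m K_l$. **Notions.** Let $C\subset\mathbb{R}^n$ be closed. For $a\in C$ let $\hat N_C(a)$ be the set of all $v$ with $\langle v,x-a\rangle\le o(\|x-a\|)$ for $x\in C$, and let $N_C(a)$ be the set of all limits $v=\lim_k v_k$ with $v_k\in\hat N_C(x_k)$, $x_k\in C$, $x_k\to a$. The set $C$ is *super-regular* at $a\in C$ if for every $\delta>0$ there is a neighbourhood $V$ of $a$ with $\langle z-y,v\rangle\le\delta\|z-y\|\|v\|$ for all $z,y\in C\cap V$ and $v\in N_C(y)$. The set $C$ is called a *manifold* if it is super-regular at all its points and $-N_C(x)=N_C(x)$ for all $x\in C$. Write $d(x,C)$ for the distance from $x$ to $C$, and $P_C(x)$ for the set of points of $C$ nearest to $x$. The sets $K_l$ have *linearly regular intersection* at $a\in K$ if $\sum_l v_l=0$ with $v_l\in N_{K_l}(a)$ forces $v_l=0$ for all $l$; they satisfy the *local metric inequality* at $a$ if there are $\beta>0$ and a neighbourhood $V$ of $a$ with $d(x,K)\le\beta\max_l d(x,K_l)$ for all $x\in V$.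 **Algorithm.** Start from $x_0\in\mathbb{R}^n$. In iteration $i=0,1,2,\dots$ put $x_i^0=x_i$ and choose any sets $S_1,\dots,S_m\subset\{1,\dots,m\}$ (possibly empty, and possibly different in each iteration) with $\bigcup_j S_j=\{1,\dots,m\}$. For $j=1,\dots,m$: choose any $x_{i,j,l}\in P_{K_l}(x_i^{j-1})$ for $l\in S_j$; for $l\in S_j$ let $H_{i,j,l}=\{x:\langle x_i^{j-1}-x_{i,j,l},\,x-x_{i,j,l}\rangle=0\}$ if $K_l$ is a manifold, and $H_{i,j,l}=\{x:\langle x_i^{j-1}-x_{i,j,l},\,x-x_{i,j,l}\rangle\le 0\}$ otherwise; choose any set $\tilde S_i^j$ of pairs $(k,l)$ with $k\le j$ and $l\in S_k$ that contains $\{j\}\times S_j$ and contains at most one pair $(k,l)$ for each $l$; put $F_i^j=\bigcap_{(k,l)\in\tilde S_i^j}H_{i,k,l}$ and $x_i^j=P_{F_i^j}(x_i^{j-1})$. Finally put $x_{i+1}=x_i^m$. **Theorem.** Let $K_1,\dots,K_m$ be super-regular at $x^*\in K$, and put $$\eta=\min\Big\{\Big\|\sum_{l=1}^m v_l\Big\|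 : v_l\in N_{K_l}(x^*),\ \sum_{l=1}^m\|v_l\|=1\Big\}\in[0,\infty]\qquad(\min\emptyset=\infty).$$ 1. $\eta>0$ if and only if $K_1,\dots,K_m$ have linearly regular intersection at $x^*$. 2. If they have linearly regular intersection at $x^*$, then they satisfy the local metric inequality at $x^*$. 3. If $\eta>0$, then there are $q\in(0,1)$ and a neighbourhood $U$ of $x^*$ such that for every $x_0\in U$ and all choices made in the algorithm, the algorithm started at $x_0$ is well defined (all the sets $F_i^j$ are nonempty), and its iterates $x_i$ converge Q-linearly to some point $\bar x\in K$: $\|x_{i+1}-\bar x\|\le q\,\|x_i-\bar x\|$ for all $i\ge 0$. In particular $\|x_i-\bar x\|\le q^i\|x_0-\bar x\|$. -/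

import Mathlib

open Filter Topology
open scoped ENNReal

namespace SetIntersection

/-- The space `ℝⁿ` with its Euclidean norm. -/
abbrev Space (n : ℕ) : Type := EuclideanSpace ℝ (Fin n)

/-- The regular normal cone of `C` at a point `a ∈ C`: all `v` with
`⟨v, x - a⟩ ≤ o(‖x - a‖)` for `x ∈ C`. -/
def regularNormalCone {n : ℕ} (C : Set (Space n)) (a : Space n) : Set (Space n) :=
  {v | ∀ ε : ℝ, 0 < ε → ∀ᶠ x in 𝓝[C] a, inner ℝ v (x - a) ≤ ε * ‖x - a‖}

/-- The limiting normal cone of `C` at a point `a ∈ C`: all limits of regular normals taken at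
points of `C` that converge to `a`. -/
def normalCone {n : ℕ} (C : Set (Space n)) (a : Space n) : Set (Space n) :=
  {v | ∃ (x w : ℕ → Space n), (∀ k, x k ∈ C) ∧ Tendsto x atTop (𝓝 a) ∧
    (∀ k, w k ∈ regularNormalCone C (x k)) ∧ Tendsto w atTop (𝓝 v)}

/-- Super-regularity of the closed set `C` at its point `a`. -/
def SuperRegularAt {n : ℕ} (C : Set (Space n)) (a : Space n) : Prop :=
  IsClosed C ∧ a ∈ C ∧ ∀ δ : ℝ, 0 < δ → ∃ V ∈ 𝓝 a, ∀ z ∈ C ∩ V, ∀ y ∈ C ∩ V,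
    ∀ v ∈ normalCone C y, inner ℝ (z - y) v ≤ δ * ‖z - y‖ * ‖v‖

/-- A "manifold" in the sense used by the algorithm: a closed set that is super-regular at each of
its points and all of whose normal cones are symmetric. -/
def IsManifoldSet {n : ℕ} (M : Set (Space n)) : Prop :=
  IsClosed M ∧ (∀ x ∈ M, SuperRegularAt M x) ∧
    ∀ x ∈ M, ∀ v ∈ normalCone M x, -v ∈ normalCone M x

/-- The local metric inequality for the sets `K l` at `a`. -/
def LocalMetricInequality {n m : ℕ} (K : Fin m → Set (Space n)) (a : Space n) : Prop :=
  ∃ β : ℝ, 0 < β ∧ ∃ V ∈ 𝓝 a, ∀ x ∈ V,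
    Metric.infDist x (⋂ l, K l) ≤ β * ⨆ l, Metric.infDist x (K l)

/-- Linearly regular intersection of the sets `K l` at `a`. -/
def LinearlyRegularIntersection {n m : ℕ} (K : Fin m → Set (Space n)) (a : Space n) : Prop :=
  ∀ v : Fin m → Space n, (∀ l, v l ∈ normalCone (K l) a) → ∑ l, v l = 0 → ∀ l, v l = 0

/-- The constant `η`: the minimal norm of a sum of normals at `a` (one for each set) whose norms
sum to `1`. It is taken in `[0, ∞]`, so that it is `∞` if there are no such normals, that is, if all
normal cones at `a` are trivial. -/
noncomputable def eta {n m : ℕ} (K : Fin m → Set (Space n)) (a : Space n) : ℝ≥0∞ :=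
  ⨅ (v : Fin m → Space n) (_ : ∀ l, v l ∈ normalCone (K l) a) (_ : ∑ l, ‖v l‖ = 1),
    ENNReal.ofReal ‖∑ l, v l‖

/-- The (set-valued) projection onto `C`: the nearest points of `C` to `x`. -/
def proj {n : ℕ} (C : Set (Space n)) (x : Space n) : Set (Space n) :=
  {y | y ∈ C ∧ dist x y = Metric.infDist x C}

/-- The halfspace, or for a manifold the hyperplane, produced by the projection `p` of `x` onto
`C`. -/
noncomputable def supportingSet {n : ℕ} (C : Set (Space n)) (x p : Space n) : Set (Space n) :=
  open Classical in
  if IsManifoldSet C then {z | inner ℝ (x - p) (z - p) = 0}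
  else {z | inner ℝ (x - p) (z - p) ≤ 0}

/-- Everything the algorithm produces or chooses. Sets and inner steps are numbered from `0`, so
that the inner step `j : Fin m` of iteration `i` leads from `x i j.castSucc` to `x i j.succ`. -/
structure Trace (n m : ℕ) where
  /-- inner iterates `x_i^0, …, x_i^m` -/
  x : ℕ → Fin (m + 1) → Space n
  /-- the index sets `S_j` chosen in iteration `i` -/
  S : ℕ → Fin m → Set (Fin m)
  /-- the sets of pairs `(k, l)` that select the constraints of the step `j` of iteration `i` -/
  T : ℕ → Fin m → Set (Fin m × Fin m)
  /-- the projections `x_{i,j,l}` of `x_i^{j-1}` onto `K l`, used for `l ∈ S_j` only -/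
  p : ℕ → Fin m → Fin m → Space n

namespace Trace

variable {n m : ℕ}

/-- The halfspace or hyperplane `H_{i,j,l}`. -/
noncomputable def H (D : Trace n m) (K : Fin m → Set (Space n)) (i : ℕ) (j l : Fin m) :
    Set (Space n) :=
  supportingSet (K l) (D.x i j.castSucc) (D.p i j l)

/-- The polyhedron `F_i^j`. -/
noncomputable def F (D : Trace n m) (K : Fin m → Set (Space n)) (i : ℕ) (j : Fin m) :
    Set (Space n) :=
  ⋂ kl ∈ D.T i j, D.H K i kl.1 kl.2

/-- The sets chosen in iteration `i` cover all indices. -/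
def Covers (D : Trace n m) (i : ℕ) : Prop := ⋃ j, D.S i j = Set.univ

/-- The choices made at the inner step `j` of iteration `i`, before the quadratic program is
solved, are admissible. -/
structure Admissible (D : Trace n m) (K : Fin m → Set (Space n)) (i : ℕ) (j : Fin m) : Prop where
  proj_mem : ∀ l ∈ D.S i j, D.p i j l ∈ proj (K l) (D.x i j.castSucc)
  current : ∀ l ∈ D.S i j, (j, l) ∈ D.T i j
  earlier : ∀ k l, (k, l) ∈ D.T i j → l ∈ D.S i k ∧ k ≤ j
  unique : ∀ k₁ k₂ l, (k₁, l) ∈ D.T i j → (k₂, l) ∈ D.T i j → k₁ = k₂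

/-- The quadratic programming step: `x_i^j` is the projection of `x_i^{j-1}` onto `F_i^j`. -/
def Solves (D : Trace n m) (K : Fin m → Set (Space n)) (i : ℕ) (j : Fin m) : Prop :=
  D.x i j.succ ∈ proj (D.F K i j) (D.x i j.castSucc)

/-- `D` is an (infinite) run of the algorithm from the starting point `x₀`. -/
structure IsRun (D : Trace n m) (K : Fin m → Set (Space n)) (x₀ : Space n) : Prop where
  start : D.x 0 0 = x₀
  covers : ∀ i, D.Covers i
  admissible : ∀ i j, D.Admissible K i j
  solves : ∀ i j, D.Solves K i j
  next : ∀ i, D.x (i + 1) 0 = D.x i (Fin.last m)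

/-- `D` is a run of the algorithm from `x₀` up to the point in the inner step `j` of iteration `i`
where the polyhedron `F_i^j` has been set up and has to be projected onto. (What `D` contains
beyond this point is irrelevant.) -/
structure IsRunUntil (D : Trace n m) (K : Fin m → Set (Space n)) (x₀ : Space n)
    (i : ℕ) (j : Fin m) : Prop where
  start : D.x 0 0 = x₀
  covers : ∀ i' ≤ i, D.Covers i'
  admissible : ∀ i' j', i' < i ∨ (i' = i ∧ j' ≤ j) → D.Admissible K i' j'
  solves : ∀ i' j', i' < i ∨ (i' = i ∧ j' < j) → D.Solves K i' j'
  next : ∀ i' < i, D.x (i' + 1) 0 = D.x i' (Fin.last m)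

end Trace

/-- Q-linear convergence of the sequence `u` to `a` with factor `q`. -/
def ConvergesQLinearly {n : ℕ} (u : ℕ → Space n) (a : Space n) (q : ℝ) : Prop :=
  Tendsto u atTop (𝓝 a) ∧ ∀ i, ‖u (i + 1) - a‖ ≤ q * ‖u i - a‖

end SetIntersection

/-!
The proof rests on two quantitative consequences of linear regularity at `a`. By compactness,
normals to the sets `K l` at points near `a` cannot nearly cancel: `κ ∑ ‖v l‖ ≤ ‖∑ v l‖`
(`LinearlyRegularIntersection.exists_transversalNear`), which also yields `η > 0`. The local
metric inequality follows by minimizing the residual `(∑ d(z, K l)²)^(1/2)` plus a small multiple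
of `‖z - x‖`: transversality forbids minimizers outside the intersection
(`mem_iInter_of_minimizes_residual`).

For the algorithm, transversality of the normals of the active constraints gives Hoffman's error
bound for the polyhedra `F` with the uniform constant `1 / κ` (`exists_solution_near`, by
separation). By super-regularity a point `y` of the intersection violates the constraints only
slightly, so some point of `F` is very close to `y` (`Trace.exists_mem_F_near`). In particular `F`
is nonempty, and projecting onto `F` acts on the distance to `y` as a projection onto a convex set
containing `y`, up to an error that is small relative to the distance of the iterate from `y`. In
one iteration the squared distance to `y` thus drops by nearly the sum of the squared step
lengths, and this sum is at least a fixed multiple of the squared distance to the intersection, by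
the metric inequality (`Trace.IsIteration.norm_sub_sq_le`).

With `y` the nearest point of the intersection this gives geometric decay of the distance to the
intersection, hence convergence to some `xbar` with `‖x i - xbar‖` bounded by a multiple of that
distance. With `y = xbar` the same inequality then gives the contraction towards `xbar`
(`Trace.exists_convergesQLinearly`).
-/

namespace SetIntersection

/-! ### Normal cones -/

/-- The limiting normal cone is a section of the closure of the graph of the regular normal cone. -/
theorem mem_normalCone_iff {n : ℕ} {C : Set (Space n)} {a v : Space n} :
    v ∈ normalCone C a ↔
      (a, v) ∈ closure {q : Space n × Space n | q.1 ∈ C ∧ q.2 ∈ regularNormalCone C q.1} := by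
  rw [mem_closure_iff_seq_limit]
  constructor
  · rintro ⟨x, w, hx, hxa, hw, hwv⟩
    exact ⟨fun k => (x k, w k), fun k => ⟨hx k, hw k⟩, hxa.prodMk_nhds hwv⟩
  · rintro ⟨q, hq, hlim⟩
    exact ⟨fun k => (q k).1, fun k => (q k).2, fun k => (hq k).1,
      (continuous_fst.tendsto _).comp hlim, fun k => (hq k).2,
      (continuous_snd.tendsto _).comp hlim⟩

theorem mem_normalCone_of_tendsto {n : ℕ} {C : Set (Space n)} {a v : Space n}
    {x w : ℕ → Space n} (hx : Tendsto x atTop (𝓝 a)) (hw : Tendsto w atTop (𝓝 v))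
    (h : ∀ k, w k ∈ normalCone C (x k)) : v ∈ normalCone C a := by
  rw [mem_normalCone_iff]
  exact isClosed_closure.mem_of_tendsto (hx.prodMk_nhds hw)
    (Eventually.of_forall fun k => mem_normalCone_iff.1 (h k))

theorem regularNormalCone_subset_normalCone {n : ℕ} {C : Set (Space n)} {a v : Space n}
    (ha : a ∈ C) (hv : v ∈ regularNormalCone C a) : v ∈ normalCone C a :=
  ⟨fun _ => a, fun _ => v, fun _ => ha, tendsto_const_nhds, fun _ => hv, tendsto_const_nhds⟩

theorem zero_mem_normalCone {n : ℕ} {C : Set (Space n)} {a : Space n} (ha : a ∈ C) :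
    (0 : Space n) ∈ normalCone C a := by
  refine regularNormalCone_subset_normalCone ha fun ε hε => Eventually.of_forall fun x => ?_
  rw [inner_zero_left]
  positivity

theorem smul_mem_normalCone {n : ℕ} {C : Set (Space n)} {a v : Space n} {t : ℝ} (ht : 0 ≤ t)
    (hv : v ∈ normalCone C a) : t • v ∈ normalCone C a := by
  obtain ⟨x, w, hx, hxa, hw, hwv⟩ := hv
  refine ⟨x, fun k => t • w k, hx, hxa, fun k ε hε => ?_, hwv.const_smul t⟩
  have ht1 : 0 < t + 1 := by linarith
  filter_upwards [hw k (ε / (t + 1)) (by positivity)] with y hy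
  rw [real_inner_smul_left]
  calc t * inner ℝ (w k) (y - x k) ≤ t * (ε / (t + 1) * ‖y - x k‖) :=
        mul_le_mul_of_nonneg_left hy ht
    _ = (t / (t + 1)) * (ε * ‖y - x k‖) := by ring
    _ ≤ 1 * (ε * ‖y - x k‖) :=
        mul_le_mul_of_nonneg_right ((div_le_one ht1).2 (by linarith)) (by positivity)
    _ = ε * ‖y - x k‖ := one_mul _

theorem norm_sub_le_norm_sub_of_mem_proj {n : ℕ} {C : Set (Space n)} {x p y : Space n}
    (hp : p ∈ proj C x) (hy : y ∈ C) : ‖x - p‖ ≤ ‖x - y‖ := by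
  rw [← dist_eq_norm, ← dist_eq_norm, hp.2]
  exact Metric.infDist_le_dist_of_mem hy

theorem norm_sub_le_of_mem_proj {n : ℕ} {C : Set (Space n)} {x p y : Space n} (hp : p ∈ proj C x)
    (hy : y ∈ C) : ‖p - y‖ ≤ 2 * ‖x - y‖ := by
  have h1 := norm_sub_le_norm_sub_of_mem_proj hp hy
  have h2 : ‖p - y‖ ≤ ‖p - x‖ + ‖x - y‖ := norm_sub_le_norm_sub_add_norm_sub _ _ _
  rw [norm_sub_rev p x] at h2
  linarith

theorem norm_sub_eq_infDist_of_mem_proj {n : ℕ} {C : Set (Space n)} {x p : Space n}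
    (hp : p ∈ proj C x) : ‖x - p‖ = Metric.infDist x C := by
  rw [← dist_eq_norm, hp.2]

theorem exists_mem_proj {n : ℕ} {C : Set (Space n)} (hC : IsClosed C) (hne : C.Nonempty)
    (x : Space n) : ∃ p, p ∈ proj C x := by
  obtain ⟨p, hp, h⟩ := hC.exists_infDist_eq_dist hne x
  exact ⟨p, hp, h.symm⟩

/-- Proximal normals are normals: `2 ⟨x - p, y - p⟩ ≤ ‖y - p‖²` for all `y ∈ C`. -/
theorem sub_mem_normalCone_of_mem_proj {n : ℕ} {C : Set (Space n)} {x p : Space n}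
    (hp : p ∈ proj C x) : x - p ∈ normalCone C p := by
  refine regularNormalCone_subset_normalCone hp.1 fun ε hε => ?_
  have hball : ∀ᶠ y in 𝓝[C] p, dist y p < ε :=
    nhdsWithin_le_nhds (Metric.ball_mem_nhds p hε)
  filter_upwards [hball, self_mem_nhdsWithin] with y hy hyC
  have h1 := norm_sub_le_norm_sub_of_mem_proj hp hyC
  have h2 : ‖x - y‖ ^ 2 = ‖x - p‖ ^ 2 - 2 * inner ℝ (x - p) (y - p) + ‖y - p‖ ^ 2 := by
    rw [← norm_sub_sq_real, sub_sub_sub_cancel_right]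
  have h3 : ‖x - p‖ ^ 2 ≤ ‖x - y‖ ^ 2 := by gcongr
  rw [dist_eq_norm] at hy
  nlinarith [norm_nonneg (y - p)]

/-! ### Uniform transversality and the constant `η` -/

/-- Normals to the sets `K l` at points within distance `ρ` of `a` do not nearly cancel: the norm of
their sum is at least `κ` times the sum of their norms. -/
def TransversalNear {n m : ℕ} (K : Fin m → Set (Space n)) (a : Space n) (κ ρ : ℝ) : Prop :=
  ∀ p v : Fin m → Space n, (∀ l, p l ∈ K l) → (∀ l, ‖p l - a‖ < ρ) →
    (∀ l, v l ∈ normalCone (K l) (p l)) → κ * ∑ l, ‖v l‖ ≤ ‖∑ l, v l‖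

/-- Linear regularity at a point is stable: by compactness of the set of normalized families of
normals and closedness of the graph of the normal cone, it holds quantitatively nearby. -/
theorem LinearlyRegularIntersection.exists_transversalNear {n m : ℕ}
    {K : Fin m → Set (Space n)} {a : Space n} (h : LinearlyRegularIntersection K a) :
    ∃ κ, 0 < κ ∧ ∃ ρ, 0 < ρ ∧ TransversalNear K a κ ρ := by
  by_contra hcon
  push Not at hcon
  have hpos : ∀ k : ℕ, (0 : ℝ) < 1 / ((k : ℝ) + 1) := fun k => by positivity
  have key : ∀ k : ℕ, ∃ p v : Fin m → Space n, (∀ l, ‖p l - a‖ < 1 / ((k : ℝ) + 1)) ∧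
      (∀ l, v l ∈ normalCone (K l) (p l)) ∧ ∑ l, ‖v l‖ = 1 ∧
      ‖∑ l, v l‖ ≤ 1 / ((k : ℝ) + 1) := by
    intro k
    have h0 := hcon _ (hpos k) _ (hpos k)
    unfold TransversalNear at h0
    push Not at h0
    obtain ⟨p, v, -, hpa, hv, hlt⟩ := h0
    have hs0 : 0 ≤ ∑ l, ‖v l‖ := Finset.sum_nonneg fun _ _ => norm_nonneg _
    have hs : 0 < ∑ l, ‖v l‖ := by
      rcases hs0.eq_or_lt with h1 | h1
      · rw [← h1, mul_zero] at hlt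
        exact absurd hlt (not_lt.2 (norm_nonneg _))
      · exact h1
    refine ⟨p, fun l => (∑ l, ‖v l‖)⁻¹ • v l, hpa,
      fun l => smul_mem_normalCone (inv_nonneg.2 hs0) (hv l), ?_, ?_⟩
    · simp only [norm_smul, norm_inv, Real.norm_of_nonneg hs0]
      rw [← Finset.mul_sum, inv_mul_cancel₀ hs.ne']
    · rw [← Finset.smul_sum, norm_smul, norm_inv, Real.norm_of_nonneg hs0, inv_mul_le_iff₀ hs,
        mul_comm]
      exact hlt.le
  choose p v hpa hv hv1 hvs using key
  have hbd : ∀ k, v k ∈ Metric.closedBall (0 : Fin m → Space n) 1 := by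
    intro k
    rw [mem_closedBall_zero_iff, pi_norm_le_iff_of_nonneg zero_le_one]
    intro l
    rw [← hv1 k]
    exact Finset.single_le_sum (f := fun l => ‖v k l‖) (fun _ _ => norm_nonneg _)
      (Finset.mem_univ l)
  obtain ⟨w, -, φ, hφ, hlim⟩ := (isCompact_closedBall _ _).tendsto_subseq hbd
  have hlim' : ∀ l, Tendsto (fun k => v (φ k) l) atTop (𝓝 (w l)) := fun l =>
    ((continuous_apply l).tendsto _).comp hlim
  have hinv : Tendsto (fun k : ℕ => 1 / ((φ k : ℝ) + 1)) atTop (𝓝 0) :=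
    tendsto_one_div_add_atTop_nhds_zero_nat.comp hφ.tendsto_atTop
  have hplim : ∀ l, Tendsto (fun k => p (φ k) l) atTop (𝓝 a) := fun l => by
    rw [tendsto_iff_norm_sub_tendsto_zero]
    exact squeeze_zero (fun _ => norm_nonneg _) (fun k => (hpa (φ k) l).le) hinv
  have hw : ∀ l, w l ∈ normalCone (K l) a := fun l =>
    mem_normalCone_of_tendsto (hplim l) (hlim' l) fun k => hv (φ k) l
  have hsum : ∑ l, w l = 0 := by
    have h1 : Tendsto (fun k => ‖∑ l, v (φ k) l‖) atTop (𝓝 ‖∑ l, w l‖) :=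
      (tendsto_finsetSum _ fun l _ => hlim' l).norm
    have h2 : Tendsto (fun k => ‖∑ l, v (φ k) l‖) atTop (𝓝 0) :=
      squeeze_zero (fun _ => norm_nonneg _) (fun k => hvs (φ k)) hinv
    exact norm_eq_zero.1 (tendsto_nhds_unique h1 h2)
  have hone : ∑ l, ‖w l‖ = 1 := by
    have h1 : Tendsto (fun k => ∑ l, ‖v (φ k) l‖) atTop (𝓝 (∑ l, ‖w l‖)) :=
      tendsto_finsetSum _ fun l _ => (hlim' l).norm
    simp only [hv1] at h1
    exact tendsto_nhds_unique h1 tendsto_const_nhds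
  have hz := h w hw hsum
  simp [hz] at hone

theorem eta_pos_iff {n m : ℕ} {K : Fin m → Set (Space n)} {a : Space n} (ha : a ∈ ⋂ l, K l) :
    0 < eta K a ↔ LinearlyRegularIntersection K a := by
  constructor
  · intro hη v hv hsum
    by_contra hne
    push Not at hne
    obtain ⟨l₀, hl₀⟩ := hne
    have hs : 0 < ∑ l, ‖v l‖ := (norm_pos_iff.2 hl₀).trans_le
      (Finset.single_le_sum (f := fun l => ‖v l‖) (fun _ _ => norm_nonneg _) (Finset.mem_univ l₀))
    have hle : eta K a ≤ ENNReal.ofReal ‖∑ l, (∑ l, ‖v l‖)⁻¹ • v l‖ := by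
      refine iInf₂_le_of_le (fun l => (∑ l, ‖v l‖)⁻¹ • v l)
        (fun l => smul_mem_normalCone (inv_nonneg.2 hs.le) (hv l)) (iInf_le_of_le ?_ le_rfl)
      simp only [norm_smul, norm_inv, Real.norm_of_nonneg hs.le]
      rw [← Finset.mul_sum, inv_mul_cancel₀ hs.ne']
    rw [← Finset.smul_sum, hsum, smul_zero, norm_zero, ENNReal.ofReal_zero] at hle
    exact absurd hη (not_lt.2 hle)
  · intro h
    obtain ⟨κ, hκ, ρ, hρ, hT⟩ := h.exists_transversalNear
    refine (ENNReal.ofReal_pos.2 hκ).trans_le (le_iInf fun v => le_iInf₂ fun hv h1 => ?_)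
    refine ENNReal.ofReal_le_ofReal ?_
    simpa [h1] using hT (fun _ => a) v (fun l => Set.mem_iInter.1 ha l) (fun l => by simpa) hv

/-! ### The local metric inequality -/

/-- If the residual `f z = (∑ d(z, K l)²)^(1/2)` penalized by `κ/2 * ‖z - x‖` is minimal at `z`,
then `z` lies in the intersection: otherwise the sum `s` of the normals `z - p l` satisfies
`‖s‖ ≥ κ f(z)`, and moving `z` in the direction `-s` decreases the residual at a rate of at least
`κ`. -/
theorem mem_iInter_of_minimizes_residual {n m : ℕ} {K : Fin m → Set (Space n)}
    {a x z : Space n} {κ ρ : ℝ} (hκ : 0 < κ) (hT : TransversalNear K a κ ρ)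
    (hclosed : ∀ l, IsClosed (K l)) (ha : a ∈ ⋂ l, K l) (hz : 3 * ‖z - a‖ < ρ)
    (hmin : ∀ w, √(∑ l, Metric.infDist z (K l) ^ 2) + κ / 2 * ‖z - x‖ ≤
      √(∑ l, Metric.infDist w (K l) ^ 2) + κ / 2 * ‖w - x‖) : z ∈ ⋂ l, K l := by
  have ha' := Set.mem_iInter.1 ha
  choose p hp using fun l => exists_mem_proj (hclosed l) ⟨a, ha' l⟩ z
  set f := √(∑ l, Metric.infDist z (K l) ^ 2) with hf
  have hf2 : f ^ 2 = ∑ l, ‖z - p l‖ ^ 2 := by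
    rw [hf, Real.sq_sqrt (Finset.sum_nonneg fun _ _ => sq_nonneg _)]
    exact Finset.sum_congr rfl fun l _ => by rw [norm_sub_eq_infDist_of_mem_proj (hp l)]
  have hf0 : 0 ≤ f := Real.sqrt_nonneg _
  rcases hf0.eq_or_lt with h0 | hfpos
  · refine Set.mem_iInter.2 fun l => ?_
    rw [← h0] at hf2
    have h1 := (Finset.sum_eq_zero_iff_of_nonneg fun l _ => sq_nonneg ‖z - p l‖).1
      (by rw [← hf2]; norm_num) l (Finset.mem_univ l)
    have h2 : z = p l := sub_eq_zero.1 (norm_eq_zero.1 (pow_eq_zero_iff two_ne_zero |>.1 h1))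
    rw [h2]
    exact (hp l).1
  exfalso
  set s := ∑ l, (z - p l) with hs
  have hsf : κ * f ≤ ‖s‖ := by
    have h1 := hT p (fun l => z - p l) (fun l => (hp l).1) (fun l => ?_)
      (fun l => sub_mem_normalCone_of_mem_proj (hp l))
    · refine le_trans (mul_le_mul_of_nonneg_left ?_ hκ.le) h1
      refine abs_le_of_sq_le_sq' ?_ (Finset.sum_nonneg fun _ _ => norm_nonneg _) |>.2
      rw [hf2]
      exact Finset.sum_sq_le_sq_sum_of_nonneg fun _ _ => norm_nonneg _
    · linarith [norm_sub_le_of_mem_proj (hp l) (ha' l), norm_nonneg (z - a)]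
  have hspos : 0 < ‖s‖ := lt_of_lt_of_le (by positivity) hsf
  obtain ⟨t, ht, htm, htf⟩ : ∃ t : ℝ, 0 < t ∧ m * t < 1 ∧ κ / 2 * (t * ‖s‖) ≤ f := by
    refine ⟨min (1 / ((m : ℝ) + 1)) (f / (κ / 2 * ‖s‖)), by positivity, ?_, ?_⟩
    · calc (m : ℝ) * min (1 / ((m : ℝ) + 1)) (f / (κ / 2 * ‖s‖)) ≤ m * (1 / ((m : ℝ) + 1)) := by
            gcongr; exact min_le_left _ _
        _ < 1 := by rw [mul_one_div, div_lt_one (by positivity)]; linarith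
    · calc κ / 2 * (min (1 / ((m : ℝ) + 1)) (f / (κ / 2 * ‖s‖)) * ‖s‖)
          ≤ κ / 2 * (f / (κ / 2 * ‖s‖) * ‖s‖) := by gcongr; exact min_le_right _ _
        _ = f := by field_simp
  have hw := hmin (z - t • s)
  have hF : ∑ l, Metric.infDist (z - t • s) (K l) ^ 2 ≤
      f ^ 2 - 2 * t * ‖s‖ ^ 2 + m * t ^ 2 * ‖s‖ ^ 2 := by
    calc ∑ l, Metric.infDist (z - t • s) (K l) ^ 2
        ≤ ∑ l, ‖(z - p l) - t • s‖ ^ 2 := by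
          refine Finset.sum_le_sum fun l _ => pow_le_pow_left₀ Metric.infDist_nonneg ?_ 2
          refine (Metric.infDist_le_dist_of_mem (hp l).1).trans_eq ?_
          rw [dist_eq_norm, sub_right_comm]
      _ = ∑ l, (‖z - p l‖ ^ 2 - 2 * t * inner ℝ (z - p l) s + t ^ 2 * ‖s‖ ^ 2) := by
          refine Finset.sum_congr rfl fun l _ => ?_
          rw [norm_sub_sq_real, real_inner_smul_right, norm_smul, mul_pow, Real.norm_eq_abs, sq_abs]
          ring
      _ = f ^ 2 - 2 * t * ‖s‖ ^ 2 + m * t ^ 2 * ‖s‖ ^ 2 := by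
          rw [Finset.sum_add_distrib, Finset.sum_sub_distrib, ← hf2, ← Finset.mul_sum, ← sum_inner,
            ← hs, real_inner_self_eq_norm_sq]
          simp
          ring
  have htri : ‖z - t • s - x‖ ≤ ‖z - x‖ + t * ‖s‖ := by
    rw [sub_right_comm]
    refine (norm_sub_le _ _).trans_eq ?_
    rw [norm_smul, Real.norm_of_nonneg ht.le]
  have hlow : f - κ / 2 * (t * ‖s‖) ≤ √(∑ l, Metric.infDist (z - t • s) (K l) ^ 2) := by
    have := mul_le_mul_of_nonneg_left htri (by positivity : 0 ≤ κ / 2)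
    linarith
  have hsq := (pow_le_pow_left₀ (by linarith) hlow 2).trans_eq
    (Real.sq_sqrt (Finset.sum_nonneg fun _ _ => sq_nonneg _)) |>.trans hF
  have h1 : t * ‖s‖ * (2 * ‖s‖ - κ * f - m * t * ‖s‖) ≤ 0 := by
    nlinarith [sq_nonneg (κ / 2 * (t * ‖s‖))]
  have h2 : 0 < 2 * ‖s‖ - κ * f - m * t * ‖s‖ := by nlinarith
  exact absurd h1 (not_le.2 (by positivity))

theorem LinearlyRegularIntersection.localMetricInequality {n m : ℕ}
    {K : Fin m → Set (Space n)} {a : Space n} (h : LinearlyRegularIntersection K a)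
    (hclosed : ∀ l, IsClosed (K l)) (ha : a ∈ ⋂ l, K l) : LocalMetricInequality K a := by
  obtain ⟨κ, hκ, ρ, hρ, hT⟩ := h.exists_transversalNear
  have ha' := Set.mem_iInter.1 ha
  refine ⟨2 * (m + 1) / κ, by positivity, Metric.ball a (ρ / 6),
    Metric.ball_mem_nhds _ (by positivity), fun x hx => ?_⟩
  rw [Metric.mem_ball, dist_eq_norm] at hx
  set f : Space n → ℝ := fun z => √(∑ l, Metric.infDist z (K l) ^ 2) with hf
  have hfnn : ∀ z, 0 ≤ f z := fun z => Real.sqrt_nonneg _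
  have hfa : f a = 0 := by simp [hf, Metric.infDist_zero_of_mem (ha' _)]
  have hcont : Continuous fun z => f z + κ / 2 * ‖z - x‖ := by
    have := fun l => Metric.continuous_infDist_pt (K l)
    fun_prop
  obtain ⟨z, hzx, hzmin⟩ := (isCompact_closedBall x ‖x - a‖).exists_isMinOn
    ⟨a, by rw [Metric.mem_closedBall, dist_eq_norm, norm_sub_rev]⟩ hcont.continuousOn
  rw [Metric.mem_closedBall, dist_eq_norm] at hzx
  -- outside the ball the penalty alone exceeds the value at `a`, where the residual vanishes
  have hmin : ∀ w, f z + κ / 2 * ‖z - x‖ ≤ f w + κ / 2 * ‖w - x‖ := by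
    intro w
    rcases le_or_gt ‖w - x‖ ‖x - a‖ with hw | hw
    · exact hzmin (by rwa [Metric.mem_closedBall, dist_eq_norm])
    · have h1 : f z + κ / 2 * ‖z - x‖ ≤ f a + κ / 2 * ‖a - x‖ :=
        hzmin (by rw [Metric.mem_closedBall, dist_eq_norm, norm_sub_rev])
      rw [hfa, norm_sub_rev a x, zero_add] at h1
      have h2 : κ / 2 * ‖x - a‖ ≤ κ / 2 * ‖w - x‖ := by gcongr
      linarith [hfnn w]
  have hza : ‖z - a‖ ≤ ‖z - x‖ + ‖x - a‖ := norm_sub_le_norm_sub_add_norm_sub _ _ _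
  have hz : z ∈ ⋂ l, K l :=
    mem_iInter_of_minimizes_residual hκ hT hclosed ha (by linarith) hmin
  have hdist : Metric.infDist x (⋂ l, K l) ≤ ‖z - x‖ := by
    rw [norm_sub_rev, ← dist_eq_norm]
    exact Metric.infDist_le_dist_of_mem hz
  have hfx : f x ≤ m * ⨆ l, Metric.infDist x (K l) := by
    calc f x ≤ ∑ l, Metric.infDist x (K l) := by
          refine Real.sqrt_le_iff.2 ⟨Finset.sum_nonneg fun _ _ => Metric.infDist_nonneg, ?_⟩
          exact Finset.sum_sq_le_sq_sum_of_nonneg fun _ _ => Metric.infDist_nonneg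
      _ ≤ ∑ _l : Fin m, ⨆ l, Metric.infDist x (K l) :=
          Finset.sum_le_sum fun l _ =>
            le_ciSup (f := fun l => Metric.infDist x (K l)) (Set.finite_range _).bddAbove l
      _ = m * ⨆ l, Metric.infDist x (K l) := by simp
  have hsup : 0 ≤ ⨆ l, Metric.infDist x (K l) := Real.iSup_nonneg fun _ => Metric.infDist_nonneg
  have h1 := hmin x
  rw [sub_self, norm_zero, mul_zero, add_zero] at h1
  rw [div_mul_eq_mul_div, le_div_iff₀ hκ]
  nlinarith [hfnn z]

/-! ### An error bound for systems of halfspaces and hyperplanes -/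

/-- Hoffman's error bound, with constant `1 / κ`, for the system `⟨u l, z - p l⟩ ≤ 0`, with equality
for `l ∈ E`: a point violating each constraint by at most `r ‖u l‖` is within `r / κ` of a solution.
The multipliers `c l` in `hκ` have the signs of Lagrange multipliers. The proof separates the
right-hand side that is to be attained from the closed convex set of attainable ones. -/
theorem exists_solution_near {V ι : Type*} [NormedAddCommGroup V] [InnerProductSpace ℝ V]
    [FiniteDimensional ℝ V] [Fintype ι] {E : Set ι} {u p : ι → V} {κ r : ℝ} (hκ0 : 0 < κ)
    (hr : 0 ≤ r)
    (hκ : ∀ c : ι → ℝ, (∀ l ∉ E, 0 ≤ c l) → κ * ∑ l, ‖c l • u l‖ ≤ ‖∑ l, c l • u l‖)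
    {w : V} (hw : ∀ l, inner ℝ (u l) (w - p l) ≤ r * ‖u l‖)
    (hwE : ∀ l ∈ E, -(r * ‖u l‖) ≤ inner ℝ (u l) (w - p l)) :
    ∃ z, (∀ l, inner ℝ (u l) (z - p l) ≤ 0) ∧ (∀ l ∈ E, inner ℝ (u l) (z - p l) = 0) ∧
      ‖z - w‖ ≤ r / κ := by
  classical
  let Λ : V →ₗ[ℝ] (ι → ℝ) := LinearMap.pi fun l => (innerₛₗ ℝ (u l))
  have hΛ : ∀ d l, Λ d l = inner ℝ (u l) d := fun d l => rfl
  let P : Set (ι → ℝ) := {s | ∀ l, 0 ≤ s l ∧ (l ∈ E → s l = 0)}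
  let A : Set (ι → ℝ) := Set.image2 (· + ·) (Λ '' Metric.closedBall 0 (r / κ)) P
  have hPclosed : IsClosed P := by
    simp only [P, Set.ofPred_forall, Set.ofPred_and]
    refine isClosed_iInter fun l => IsClosed.inter
      (isClosed_le continuous_const (continuous_apply l)) (isClosed_iInter fun _ =>
        isClosed_eq (continuous_apply l) continuous_const)
  have hPconv : Convex ℝ P := by
    intro s hs t ht a b ha hb _ l
    have h1 := (hs l).1
    have h2 := (ht l).1
    refine ⟨?_, fun hl => ?_⟩
    · simp only [Pi.add_apply, Pi.smul_apply, smul_eq_mul]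
      positivity
    · simp [(hs l).2 hl, (ht l).2 hl]
  have hAclosed : IsClosed A :=
    IsClosed.add_left_of_isCompact hPclosed
      ((isCompact_closedBall _ _).image (LinearMap.continuous_of_finiteDimensional Λ))
  have hAconv : Convex ℝ A := ((convex_closedBall _ _).linear_image Λ).add hPconv
  have hmem : (fun l => -inner ℝ (u l) (w - p l)) ∈ A := by
    by_contra hnot
    obtain ⟨f, α, hfb, hfA⟩ := geometric_hahn_banach_point_closed hAconv hAclosed hnot
    set c : ι → ℝ := fun l => f (Pi.single l 1) with hc
    have hf : ∀ s, f s = ∑ l, c l * s l := by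
      intro s
      have h1 := LinearMap.pi_apply_eq_sum_univ (f : (ι → ℝ) →ₗ[ℝ] ℝ) s
      rw [ContinuousLinearMap.coe_coe] at h1
      rw [h1]
      refine Finset.sum_congr rfl fun l _ => ?_
      rw [smul_eq_mul, mul_comm, hc]
      congr 2
      ext j
      simp [Pi.single_apply, eq_comm]
    have hAmem : ∀ d s, ‖d‖ ≤ r / κ → s ∈ P → Λ d + s ∈ A := fun d s hd hs =>
      Set.mem_image2_of_mem (Set.mem_image_of_mem _ (mem_closedBall_zero_iff.2 hd)) hs
    have hP0 : (0 : ι → ℝ) ∈ P := fun l => ⟨le_rfl, fun _ => rfl⟩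
    have hcnn : ∀ l ∉ E, 0 ≤ c l := by
      intro l hl
      by_contra hneg
      push Not at hneg
      -- a negative multiplier would make `f` unbounded below on the ray in direction `l`
      set t := max 0 (α / c l) with ht
      have h1 := hfA _ (hAmem 0 (Pi.single l t) (by simp; positivity) (fun j => by
        rcases eq_or_ne j l with rfl | hj
        · simp [hl, ht]
        · simp [Pi.single_eq_of_ne hj]))
      rw [map_zero, zero_add, hf, Finset.sum_eq_single l
        (fun j _ hj => by rw [Pi.single_eq_of_ne hj, mul_zero]) (by simp), Pi.single_eq_same] at h1
      have h2 : c l * t ≤ c l * (α / c l) := mul_le_mul_of_nonpos_left (le_max_right _ _) hneg.le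
      rw [mul_div_cancel₀ _ hneg.ne] at h2
      linarith
    set g := ∑ l, c l • u l with hg
    have hfΛ : ∀ d, f (Λ d) = inner ℝ g d := by
      intro d
      rw [hf, hg, sum_inner]
      exact Finset.sum_congr rfl fun l _ => by rw [hΛ, real_inner_smul_left]
    -- the point of the ball at which `f ∘ Λ` is smallest
    obtain ⟨d, hd, hdg⟩ : ∃ d : V, ‖d‖ ≤ r / κ ∧ inner ℝ g d ≤ -(r / κ * ‖g‖) := by
      rcases eq_or_ne g 0 with h0 | h0
      · exact ⟨0, by rw [norm_zero]; positivity, by simp [h0]⟩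
      · have h0' : ‖g‖ ≠ 0 := norm_ne_zero_iff.2 h0
        refine ⟨-((r / κ / ‖g‖) • g), ?_, ?_⟩
        · rw [norm_neg, norm_smul, Real.norm_of_nonneg (by positivity), div_mul_cancel₀ _ h0']
        · rw [inner_neg_right, real_inner_smul_right, real_inner_self_eq_norm_sq]
          apply le_of_eq
          field_simp
    have h1 := hfA _ (hAmem d 0 hd hP0)
    rw [add_zero, hfΛ] at h1
    have h2 : -(r * ∑ l, ‖c l • u l‖) ≤ f (fun l => -inner ℝ (u l) (w - p l)) := by
      rw [hf, Finset.mul_sum, ← Finset.sum_neg_distrib]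
      refine Finset.sum_le_sum fun l _ => ?_
      rw [norm_smul, Real.norm_eq_abs]
      by_cases hl : l ∈ E
      · have h3 : |inner ℝ (u l) (w - p l)| ≤ r * ‖u l‖ := abs_le.2 ⟨hwE l hl, hw l⟩
        have h4 := mul_le_mul_of_nonneg_left h3 (abs_nonneg (c l))
        rw [← abs_mul] at h4
        linarith [le_abs_self (c l * inner ℝ (u l) (w - p l))]
      · rw [abs_of_nonneg (hcnn l hl)]
        have h4 := mul_le_mul_of_nonneg_left (hw l) (hcnn l hl)
        linarith
    have h3 : r * ∑ l, ‖c l • u l‖ ≤ r / κ * ‖g‖ := by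
      rw [div_mul_eq_mul_div, le_div_iff₀ hκ0]
      nlinarith [mul_le_mul_of_nonneg_left (hκ c hcnn) hr]
    linarith
  obtain ⟨_, ⟨d, hd, rfl⟩, s, hs, heq⟩ := hmem
  have hval : ∀ l, inner ℝ (u l) (w + d - p l) = -s l := by
    intro l
    have h1 : inner ℝ (u l) d + s l = -inner ℝ (u l) (w - p l) := congrFun heq l
    rw [add_sub_right_comm, inner_add_right]
    linarith
  refine ⟨w + d, fun l => ?_, fun l hl => ?_, ?_⟩
  · rw [hval]
    linarith [(hs l).1]
  · rw [hval, (hs l).2 hl, neg_zero]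
  · rw [add_sub_cancel_left]
    exact mem_closedBall_zero_iff.1 hd

/-! ### Projections onto convex sets -/

theorem inner_le_zero_of_mem_proj {n : ℕ} {C : Set (Space n)} {x p z : Space n} (hC : Convex ℝ C)
    (hp : p ∈ proj C x) (hz : z ∈ C) : inner ℝ (x - p) (z - p) ≤ 0 := by
  refine (norm_eq_iInf_iff_real_inner_le_zero hC hp.1).1 ?_ z hz
  rw [norm_sub_eq_infDist_of_mem_proj hp, Metric.infDist_eq_iInf]
  simp only [dist_eq_norm]

/-- The projection of `x` onto a convex set that contains a point close to `y` is hardly farther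
from `y` than `x` is. -/
theorem norm_sub_le_of_mem_proj_of_convex {n : ℕ} {C : Set (Space n)} {x p y z : Space n} {e : ℝ}
    (hC : Convex ℝ C) (hp : p ∈ proj C x) (hz : z ∈ C) (hzy : ‖z - y‖ ≤ e) :
    ‖p - y‖ ≤ ‖x - y‖ + 2 * e := by
  have h1 := inner_le_zero_of_mem_proj hC hp hz
  have h2 : ‖x - z‖ ^ 2 = ‖x - p‖ ^ 2 - 2 * inner ℝ (x - p) (z - p) + ‖z - p‖ ^ 2 := by
    rw [← norm_sub_sq_real, sub_sub_sub_cancel_right]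
  have h3 : ‖z - p‖ ≤ ‖x - z‖ := by
    refine abs_le_of_sq_le_sq' ?_ (norm_nonneg _) |>.2
    nlinarith [sq_nonneg ‖x - p‖]
  rw [norm_sub_rev z p] at h3
  have h4 : ‖p - y‖ ≤ ‖p - z‖ + ‖z - y‖ := norm_sub_le_norm_sub_add_norm_sub _ _ _
  have h5 : ‖x - z‖ ≤ ‖x - y‖ + ‖y - z‖ := norm_sub_le_norm_sub_add_norm_sub _ _ _
  rw [norm_sub_rev y z] at h5
  linarith

theorem norm_sub_sq_le_of_mem_proj_of_convex {n : ℕ} {C : Set (Space n)} {x p y z : Space n}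
    {e : ℝ} (hC : Convex ℝ C) (hp : p ∈ proj C x) (hz : z ∈ C) (hzy : ‖z - y‖ ≤ e) :
    ‖p - y‖ ^ 2 ≤ ‖x - y‖ ^ 2 - ‖x - p‖ ^ 2 + 2 * (‖x - p‖ * e) := by
  have h1 := inner_le_zero_of_mem_proj hC hp hz
  have h2 : ‖x - y‖ ^ 2 = ‖x - p‖ ^ 2 - 2 * inner ℝ (x - p) (y - p) + ‖y - p‖ ^ 2 := by
    rw [← norm_sub_sq_real, sub_sub_sub_cancel_right]
  have h3 : inner ℝ (x - p) (y - p) = inner ℝ (x - p) (z - p) - inner ℝ (x - p) (z - y) := by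
    rw [← inner_sub_right, sub_sub_sub_cancel_left]
  have h4 : -(‖x - p‖ * ‖z - y‖) ≤ inner ℝ (x - p) (z - y) :=
    (abs_le.1 (abs_real_inner_le_norm _ _)).1
  have h5 : ‖x - p‖ * ‖z - y‖ ≤ ‖x - p‖ * e := by gcongr
  rw [norm_sub_rev p y]
  linarith

/-! ### Sums along finite sequences -/

theorem norm_sub_add_norm_sub_le_sum {V : Type*} [SeminormedAddCommGroup V] {m : ℕ}
    (f : Fin (m + 1) → V) (j : Fin m) :
    ‖f 0 - f j.castSucc‖ + ‖f j.castSucc - f j.succ‖ ≤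
      ∑ k : Fin m, ‖f k.castSucc - f k.succ‖ := by
  have hins : ∀ j : Fin m, Finset.univ.filter (fun k : Fin m => k.castSucc < j.succ) =
      insert j (Finset.univ.filter fun k : Fin m => k.castSucc < j.castSucc) := by
    intro j
    ext k
    simp only [Finset.mem_filter, Finset.mem_univ, true_and, Finset.mem_insert, Fin.lt_def,
      Fin.ext_iff, Fin.val_castSucc, Fin.val_succ]
    omega
  have key : ∀ j : Fin (m + 1), ‖f 0 - f j‖ ≤
      ∑ k ∈ Finset.univ.filter (fun k : Fin m => k.castSucc < j), ‖f k.castSucc - f k.succ‖ := by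
    intro j
    induction j using Fin.induction with
    | zero => simp
    | succ j ih =>
      rw [hins, Finset.sum_insert (by simp)]
      have : ‖f 0 - f j.succ‖ ≤ ‖f 0 - f j.castSucc‖ + ‖f j.castSucc - f j.succ‖ :=
        norm_sub_le_norm_sub_add_norm_sub _ _ _
      linarith
  have h1 := key j.castSucc
  have h2 : ∑ k ∈ Finset.univ.filter (fun k : Fin m => k.castSucc < j.succ),
      ‖f k.castSucc - f k.succ‖ ≤ ∑ k : Fin m, ‖f k.castSucc - f k.succ‖ :=
    Finset.sum_le_sum_of_subset_of_nonneg (Finset.subset_univ _) fun _ _ _ => norm_nonneg _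
  rw [hins, Finset.sum_insert (by simp)] at h2
  linarith

theorem le_add_sum_of_le_add {m : ℕ} {a : Fin (m + 1) → ℝ} {b : Fin m → ℝ}
    (h : ∀ j : Fin m, a j.succ ≤ a j.castSucc + b j) : a (Fin.last m) ≤ a 0 + ∑ j, b j := by
  have h1 := Fin.sum_univ_succ a
  have h2 := Fin.sum_univ_castSucc a
  have h3 := Finset.sum_le_sum fun j (_ : j ∈ Finset.univ) => h j
  rw [Finset.sum_add_distrib] at h3
  linarith

/-! ### One iteration of the algorithm -/

/-- The super-regularity inequality with constant `δ` on the ball of radius `ρ` about `a`. -/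
def SuperRegularNear {n : ℕ} (C : Set (Space n)) (a : Space n) (δ ρ : ℝ) : Prop :=
  ∀ z ∈ C, ∀ y ∈ C, ‖z - a‖ < ρ → ‖y - a‖ < ρ →
    ∀ v ∈ normalCone C y, inner ℝ (z - y) v ≤ δ * ‖z - y‖ * ‖v‖

theorem SuperRegularAt.exists_superRegularNear {n : ℕ} {C : Set (Space n)} {a : Space n}
    (h : SuperRegularAt C a) {δ : ℝ} (hδ : 0 < δ) : ∃ ρ, 0 < ρ ∧ SuperRegularNear C a δ ρ := by
  obtain ⟨V, hV, hin⟩ := h.2.2 δ hδ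
  obtain ⟨ρ, hρ, hsub⟩ := Metric.mem_nhds_iff.1 hV
  refine ⟨ρ, hρ, fun z hz y hy hza hya v hv => hin z ⟨hz, hsub ?_⟩ y ⟨hy, hsub ?_⟩ v hv⟩
  · rwa [Metric.mem_ball, dist_eq_norm]
  · rwa [Metric.mem_ball, dist_eq_norm]

/-- The quantitative regularity of the sets `K l` on the ball of radius `ρ` about the common point
`a` that drives the algorithm. The super-regularity constant `κ * ε` is small compared with the
transversality constant `κ`, and `ε` is small compared with `1 / m`, where `m` is the number of
inner steps. -/
structure RegularNear {n m : ℕ} (K : Fin m → Set (Space n)) (a : Space n) (κ β ε ρ : ℝ) :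
    Prop where
  isClosed : ∀ l, IsClosed (K l)
  mem : a ∈ ⋂ l, K l
  kappa_pos : 0 < κ
  beta_pos : 0 < β
  eps_pos : 0 < ε
  eps_mul_le : 8 * ε * m ≤ 1
  transversal : TransversalNear K a κ ρ
  superRegular : ∀ l, SuperRegularNear (K l) a (κ * ε) ρ
  metric : ∀ x, ‖x - a‖ < ρ →
    Metric.infDist x (⋂ l, K l) ≤ β * ⨆ l, Metric.infDist x (K l)

theorem smul_mem_normalCone_of_isManifoldSet {n : ℕ} {C : Set (Space n)} {a v : Space n}
    (hC : IsManifoldSet C) (ha : a ∈ C) (hv : v ∈ normalCone C a) (t : ℝ) :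
    t • v ∈ normalCone C a := by
  rcases le_total 0 t with ht | ht
  · exact smul_mem_normalCone ht hv
  · rw [← neg_smul_neg]
    exact smul_mem_normalCone (neg_nonneg.2 ht) (hC.2.2 a ha v hv)

theorem convex_supportingSet {n : ℕ} (C : Set (Space n)) (x p : Space n) :
    Convex ℝ (supportingSet C x p) := by
  have hval : ∀ y z : Space n, ∀ s t : ℝ, s + t = 1 → inner ℝ (x - p) (s • y + t • z - p) =
      s * inner ℝ (x - p) (y - p) + t * inner ℝ (x - p) (z - p) := by
    intro y z s t hst
    rw [← real_inner_smul_right, ← real_inner_smul_right, ← inner_add_right]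
    congr 1
    rw [smul_sub, smul_sub, sub_add_sub_comm, ← add_smul, hst, one_smul]
  unfold supportingSet
  split_ifs
  · intro y hy z hz s t hs ht hst
    simp only [Set.mem_ofPred_eq] at hy hz ⊢
    rw [hval y z s t hst, hy, hz]
    simp
  · intro y hy z hz s t hs ht hst
    simp only [Set.mem_ofPred_eq] at hy hz ⊢
    rw [hval y z s t hst]
    nlinarith

theorem inner_le_zero_of_mem_supportingSet {n : ℕ} {C : Set (Space n)} {x p z : Space n}
    (hz : z ∈ supportingSet C x p) : inner ℝ (x - p) (z - p) ≤ 0 := by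
  unfold supportingSet at hz
  split_ifs at hz
  · exact le_of_eq hz
  · exact hz

theorem mem_supportingSet {n : ℕ} {C : Set (Space n)} {x p z : Space n}
    (hle : inner ℝ (x - p) (z - p) ≤ 0) (heq : IsManifoldSet C → inner ℝ (x - p) (z - p) = 0) :
    z ∈ supportingSet C x p := by
  unfold supportingSet
  split_ifs with h
  · exact heq h
  · exact hle

namespace Trace

variable {n m : ℕ} {K : Fin m → Set (Space n)} {a y : Space n} {κ β ε ρ : ℝ} {D : Trace n m}
  {i : ℕ}

theorem convex_F (D : Trace n m) (K : Fin m → Set (Space n)) (i : ℕ) (j : Fin m) :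
    Convex ℝ (D.F K i j) :=
  convex_iInter₂ fun _ _ => convex_supportingSet _ _ _

/-- Every point `y` of the intersection is nearly feasible for the quadratic program: by
super-regularity `y` violates the constraints only slightly, and by transversality the error bound
for the constraints has a uniform constant. -/
theorem exists_mem_F_near (h : RegularNear K a κ β ε ρ) {j : Fin m} {M : ℝ}
    (hadm : ∀ k ≤ j, D.Admissible K i k) (hy : y ∈ ⋂ l, K l)
    (hM : ∀ k ≤ j, ‖D.x i k.castSucc - y‖ ≤ M) (hMρ : 2 * M + ‖y - a‖ < ρ) :
    ∃ z ∈ D.F K i j, ‖z - y‖ ≤ ε * (2 * M) := by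
  have hM0 : 0 ≤ M := (norm_nonneg _).trans (hM j le_rfl)
  have hκ := h.kappa_pos
  have hε := h.eps_pos
  have hy' := Set.mem_iInter.1 hy
  -- indices without a constraint get the void constraint with normal `0`
  have hdata : ∀ l, ∃ u p : Space n, p ∈ K l ∧ ‖p - y‖ ≤ 2 * M ∧ u ∈ normalCone (K l) p ∧
      ∀ k, (k, l) ∈ D.T i j → D.x i k.castSucc - D.p i k l = u ∧ D.p i k l = p := by
    intro l
    by_cases hl : ∃ k, (k, l) ∈ D.T i j
    · obtain ⟨k, hk⟩ := hl
      obtain ⟨hkS, hkj⟩ := (hadm j le_rfl).earlier k l hk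
      have hp := (hadm k hkj).proj_mem l hkS
      refine ⟨_, _, hp.1, ?_, sub_mem_normalCone_of_mem_proj hp, fun k' hk' => ?_⟩
      · linarith [norm_sub_le_of_mem_proj hp (hy' l), hM k hkj]
      · rw [(hadm j le_rfl).unique k' k l hk' hk]
        exact ⟨rfl, rfl⟩
    · exact ⟨0, y, hy' l, by simpa using hM0, zero_mem_normalCone (hy' l),
        fun k hk => absurd ⟨k, hk⟩ hl⟩
  choose u p hpK hpy hu hup using hdata
  have hpa : ∀ l, ‖p l - a‖ < ρ := fun l => by
    have : ‖p l - a‖ ≤ ‖p l - y‖ + ‖y - a‖ := norm_sub_le_norm_sub_add_norm_sub _ _ _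
    linarith [hpy l]
  have hya : ‖y - a‖ < ρ := by linarith
  have hbound : ∀ l, ∀ v ∈ normalCone (K l) (p l),
      inner ℝ v (y - p l) ≤ κ * ε * (2 * M) * ‖v‖ := by
    intro l v hv
    rw [real_inner_comm]
    refine (h.superRegular l y (hy' l) (p l) (hpK l) hya (hpa l) v hv).trans ?_
    rw [norm_sub_rev]
    gcongr
    exact hpy l
  obtain ⟨z, hz, hzE, hzy⟩ := exists_solution_near (E := {l | IsManifoldSet (K l)}) (u := u)
    (p := p) (w := y) (r := κ * ε * (2 * M)) hκ (by positivity)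
    (fun c hc => h.transversal p (fun l => c l • u l) hpK hpa fun l => by
      by_cases hl : IsManifoldSet (K l)
      · exact smul_mem_normalCone_of_isManifoldSet hl (hpK l) (hu l) _
      · exact smul_mem_normalCone (hc l hl) (hu l))
    (fun l => hbound l _ (hu l))
    (fun l hl => by
      have h1 := hbound l _ (hl.2.2 _ (hpK l) _ (hu l))
      rw [inner_neg_left, norm_neg] at h1
      linarith)
  refine ⟨z, Set.mem_iInter₂.2 fun kl hkl => ?_, hzy.trans_eq (by field_simp)⟩
  obtain ⟨hu', hp'⟩ := hup kl.2 kl.1 hkl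
  refine mem_supportingSet ?_ fun hm => ?_
  · rw [hu', hp']
    exact hz _
  · rw [hu', hp']
    exact hzE _ hm

/-- The inner iterates hardly move away from a point of the intersection. -/
theorem norm_sub_le_of_steps (h : RegularNear K a κ β ε ρ) (hy : y ∈ ⋂ l, K l)
    (hρ : 4 * ‖D.x i 0 - y‖ + ‖y - a‖ < ρ) (j : Fin (m + 1))
    (hadm : ∀ k : Fin m, k.castSucc < j → D.Admissible K i k)
    (hsol : ∀ k : Fin m, k.castSucc < j → D.Solves K i k) :
    ∀ k ≤ j, ‖D.x i k - y‖ ≤ 2 * ‖D.x i 0 - y‖ := by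
  have hε := h.eps_pos
  set R := ‖D.x i 0 - y‖ with hR
  have hR0 : 0 ≤ R := norm_nonneg _
  have hsmall : ∀ k : Fin (m + 1), (1 + 8 * ε * (k : ℕ)) * R ≤ 2 * R := by
    intro k
    have h1 : ((k : ℕ) : ℝ) ≤ m := by exact_mod_cast Fin.is_le k
    have h2 : 8 * ε * (k : ℕ) ≤ 8 * ε * m := by gcongr
    have h3 := h.eps_mul_le
    exact mul_le_mul_of_nonneg_right (by linarith) hR0
  suffices hs : ∀ k ≤ j, ‖D.x i k - y‖ ≤ (1 + 8 * ε * (k : ℕ)) * R from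
    fun k hk => (hs k hk).trans (hsmall k)
  induction j using Fin.induction with
  | zero =>
    intro k hk
    obtain rfl := Fin.le_zero_iff.1 hk
    simp [hR]
  | succ j ih =>
    have ih' := ih (fun k hk => hadm k (hk.trans j.castSucc_lt_succ))
      (fun k hk => hsol k (hk.trans j.castSucc_lt_succ))
    intro k hk
    rcases hk.lt_or_eq with hlt | rfl
    · exact ih' k (Fin.le_castSucc_iff.2 hlt)
    · obtain ⟨z, hz, hzy⟩ := exists_mem_F_near (M := 2 * R) h
        (fun k hk => hadm k (Fin.castSucc_lt_succ_iff.2 hk)) hy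
        (fun k hk => (ih' _ (Fin.castSucc_le_castSucc_iff.2 hk)).trans (hsmall _)) (by linarith)
      have h1 := norm_sub_le_of_mem_proj_of_convex (D.convex_F K i j)
        (hsol j j.castSucc_lt_succ) hz hzy
      have h2 := ih' j.castSucc le_rfl
      rw [Fin.val_castSucc] at h2
      rw [Fin.val_succ]
      push_cast
      linarith

theorem nonempty_F (h : RegularNear K a κ β ε ρ) (hρ : 4 * ‖D.x i 0 - a‖ < ρ) {j : Fin m}
    (hadm : ∀ k ≤ j, D.Admissible K i k) (hsol : ∀ k < j, D.Solves K i k) :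
    (D.F K i j).Nonempty := by
  have h1 := norm_sub_le_of_steps h h.mem (by simpa using hρ) j.castSucc
    (fun k hk => hadm k (Fin.castSucc_lt_castSucc_iff.1 hk).le)
    (fun k hk => hsol k (Fin.castSucc_lt_castSucc_iff.1 hk))
  obtain ⟨z, hz, -⟩ := exists_mem_F_near (M := 2 * ‖D.x i 0 - a‖) h hadm h.mem
    (fun k hk => h1 _ (Fin.castSucc_le_castSucc_iff.2 hk)) (by rw [sub_self, norm_zero]; linarith)
  exact ⟨z, hz⟩

/-- Iteration `i` has been carried out completely, and iteration `i + 1` starts where it ended. -/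
structure IsIteration (D : Trace n m) (K : Fin m → Set (Space n)) (i : ℕ) : Prop where
  covers : D.Covers i
  admissible : ∀ j, D.Admissible K i j
  solves : ∀ j, D.Solves K i j
  next : D.x (i + 1) 0 = D.x i (Fin.last m)

/-- The step that takes the constraint of `K l` into account is at least as long as the distance to
`K l` at that time, so the total length of the steps bounds the distance from the start to `K l`. -/
theorem IsIteration.infDist_le_sum (hD : D.IsIteration K i) (l : Fin m) :
    Metric.infDist (D.x i 0) (K l) ≤ ∑ k : Fin m, ‖D.x i k.castSucc - D.x i k.succ‖ := by
  have hl : l ∈ ⋃ j, D.S i j := by rw [hD.covers]; exact Set.mem_univ l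
  obtain ⟨j, hj⟩ := Set.mem_iUnion.1 hl
  have hp := (hD.admissible j).proj_mem l hj
  have hH : D.x i j.succ ∈ D.H K i j l :=
    Set.mem_iInter₂.1 (hD.solves j).1 (j, l) ((hD.admissible j).current l hj)
  have h1 := inner_le_zero_of_mem_supportingSet hH
  set u := D.x i j.castSucc - D.p i j l with hu
  have h2 : ‖u‖ * ‖u‖ ≤ ‖u‖ * ‖D.x i j.castSucc - D.x i j.succ‖ := by
    calc ‖u‖ * ‖u‖ = inner ℝ u u := (real_inner_self_eq_norm_mul_norm u).symm
      _ = inner ℝ u (D.x i j.castSucc - D.x i j.succ) +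
            inner ℝ u (D.x i j.succ - D.p i j l) := by
          rw [← inner_add_right, sub_add_sub_cancel]
      _ ≤ inner ℝ u (D.x i j.castSucc - D.x i j.succ) := by linarith
      _ ≤ _ := real_inner_le_norm _ _
  have h3 : ‖u‖ ≤ ‖D.x i j.castSucc - D.x i j.succ‖ := by
    rcases (norm_nonneg u).eq_or_lt with h0 | h0
    · rw [← h0]
      exact norm_nonneg _
    · exact le_of_mul_le_mul_left h2 h0
  rw [hu, norm_sub_eq_infDist_of_mem_proj hp] at h3
  have h4 : Metric.infDist (D.x i 0) (K l) ≤
      Metric.infDist (D.x i j.castSucc) (K l) + dist (D.x i 0) (D.x i j.castSucc) :=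
    Metric.infDist_le_infDist_add_dist
  rw [dist_eq_norm] at h4
  linarith [norm_sub_add_norm_sub_le_sum (D.x i) j]

/-- The decrease of the squared distance to a point `y` of the intersection in one iteration: up to
a small relative error it is at least the sum of the squared lengths of the steps, which by the
metric inequality is at least a fixed multiple of the squared distance to the intersection. -/
theorem IsIteration.norm_sub_sq_le (h : RegularNear K a κ β ε ρ) (hD : D.IsIteration K i)
    (hy : y ∈ ⋂ l, K l) (hρ : 4 * ‖D.x i 0 - y‖ + ‖y - a‖ < ρ) :
    ‖D.x (i + 1) 0 - y‖ ^ 2 ≤ (1 + 32 * ε * m) * ‖D.x i 0 - y‖ ^ 2 -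
      1 / ((m + 1) * β ^ 2) * Metric.infDist (D.x i 0) (⋂ l, K l) ^ 2 := by
  have hε := h.eps_pos
  have hβ := h.beta_pos
  have hb := norm_sub_le_of_steps h hy hρ (Fin.last m) (fun k _ => hD.admissible k)
    (fun k _ => hD.solves k)
  set R := ‖D.x i 0 - y‖ with hR
  have hR0 : 0 ≤ R := norm_nonneg _
  set s : Fin m → ℝ := fun k => ‖D.x i k.castSucc - D.x i k.succ‖ with hs
  have hs0 : ∀ k, 0 ≤ s k := fun k => norm_nonneg _
  have hstep : ∀ j : Fin m, ‖D.x i j.succ - y‖ ^ 2 ≤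
      ‖D.x i j.castSucc - y‖ ^ 2 + (32 * ε * R ^ 2 - s j ^ 2) := by
    intro j
    obtain ⟨z, hz, hzy⟩ := exists_mem_F_near (M := 2 * R) (j := j) h
      (fun k _ => hD.admissible k) hy (fun k _ => hb _ (Fin.le_last _)) (by linarith)
    have h1 := norm_sub_sq_le_of_mem_proj_of_convex (D.convex_F K i j) (hD.solves j) hz hzy
    have h2 : s j ≤ ‖D.x i j.castSucc - y‖ + ‖y - D.x i j.succ‖ :=
      norm_sub_le_norm_sub_add_norm_sub _ _ _
    rw [norm_sub_rev y] at h2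
    have h3 : s j ≤ 4 * R := by linarith [hb _ (Fin.le_last j.castSucc), hb _ (Fin.le_last j.succ)]
    have h4 : s j * (ε * (2 * (2 * R))) ≤ 4 * R * (ε * (2 * (2 * R))) := by gcongr
    change _ ≤ _ - s j ^ 2 + 2 * (s j * _) at h1
    linarith
  have htel := le_add_sum_of_le_add (a := fun j => ‖D.x i j - y‖ ^ 2) hstep
  rw [Finset.sum_sub_distrib, Finset.sum_const, Finset.card_univ, Fintype.card_fin,
    nsmul_eq_mul] at htel
  have hdist : Metric.infDist (D.x i 0) (⋂ l, K l) ≤ β * ∑ k, s k := by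
    have hxa : ‖D.x i 0 - a‖ ≤ R + ‖y - a‖ := norm_sub_le_norm_sub_add_norm_sub _ _ _
    refine (h.metric _ (by linarith)).trans (mul_le_mul_of_nonneg_left ?_ hβ.le)
    exact Real.iSup_le (fun l => hD.infDist_le_sum l) (Finset.sum_nonneg fun k _ => hs0 k)
  have hsq : Metric.infDist (D.x i 0) (⋂ l, K l) ^ 2 ≤ ∑ k, s k ^ 2 * ((m + 1) * β ^ 2) := by
    rw [← Finset.sum_mul]
    have h1 := pow_le_pow_left₀ Metric.infDist_nonneg hdist 2
    have h2 : (∑ k, s k) ^ 2 ≤ m * ∑ k, s k ^ 2 := by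
      simpa using sq_sum_le_card_mul_sum_sq (s := Finset.univ) (f := s)
    have h3 : 0 ≤ ∑ k, s k ^ 2 := Finset.sum_nonneg fun k _ => sq_nonneg _
    have h4 : β ^ 2 * (∑ k, s k) ^ 2 ≤ β ^ 2 * ((m + 1) * ∑ k, s k ^ 2) := by
      gcongr
      linarith
    rw [mul_pow] at h1
    linarith
  have hfin : 1 / ((m + 1) * β ^ 2) * Metric.infDist (D.x i 0) (⋂ l, K l) ^ 2 ≤ ∑ k, s k ^ 2 := by
    rw [one_div_mul_eq_div, div_le_iff₀ (by positivity), Finset.sum_mul]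
    exact hsq
  rw [hD.next]
  linarith

/-! ### Linear convergence -/

/-- The distance to the intersection decreases by a fixed factor, and the iterate moves by at most a
multiple of it: the case of the nearest point `y` of the intersection in `norm_sub_sq_le`. There,
`c` is the decrease of the squared distance, relative to the squared distance to the
intersection. -/
theorem IsIteration.infDist_decrease (h : RegularNear K a κ β ε ρ) {c : ℝ}
    (hc : c = 1 / ((m + 1) * β ^ 2)) (hc1 : c ≤ 1) (hεc : 32 * ε * m ≤ c ^ 3 / 288)
    (hD : D.IsIteration K i) (hρ : 6 * ‖D.x i 0 - a‖ < ρ) :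
    Metric.infDist (D.x (i + 1) 0) (⋂ l, K l) ≤
        (1 - c / 4) * Metric.infDist (D.x i 0) (⋂ l, K l) ∧
      ‖D.x (i + 1) 0 - D.x i 0‖ ≤ 3 * Metric.infDist (D.x i 0) (⋂ l, K l) := by
  have hβ := h.beta_pos
  have hc0 : 0 < c := by rw [hc]; positivity
  obtain ⟨y, hy⟩ := exists_mem_proj (isClosed_iInter h.isClosed) ⟨a, h.mem⟩ (D.x i 0)
  have h1 := norm_sub_le_norm_sub_of_mem_proj hy h.mem
  have h2 := norm_sub_le_of_mem_proj hy h.mem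
  have h3 : 4 * ‖D.x i 0 - y‖ + ‖y - a‖ < ρ := by linarith
  have h4 := hD.norm_sub_sq_le h hy.1 h3
  have h5 := norm_sub_le_of_steps h hy.1 h3 (Fin.last m) (fun k _ => hD.admissible k)
    (fun k _ => hD.solves k) (Fin.last m) le_rfl
  rw [← hD.next] at h5
  rw [← hc] at h4
  set d := Metric.infDist (D.x i 0) (⋂ l, K l) with hd
  have hyd : ‖D.x i 0 - y‖ = d := norm_sub_eq_infDist_of_mem_proj hy
  have hd0 : 0 ≤ d := Metric.infDist_nonneg
  rw [hyd] at h4 h5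
  have hcc : c ^ 3 ≤ c := by
    calc c ^ 3 ≤ c ^ 1 := pow_le_pow_of_le_one hc0.le hc1 (by norm_num)
      _ = c := pow_one c
  refine ⟨?_, ?_⟩
  · have h6 : Metric.infDist (D.x (i + 1) 0) (⋂ l, K l) ≤ ‖D.x (i + 1) 0 - y‖ := by
      rw [← dist_eq_norm]
      exact Metric.infDist_le_dist_of_mem hy.1
    refine h6.trans (abs_le_of_sq_le_sq' ?_ (mul_nonneg (by linarith) hd0)).2
    rw [mul_pow]
    have h7 : (1 + 32 * ε * m - c) * d ^ 2 ≤ (1 - c / 4) ^ 2 * d ^ 2 :=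
      mul_le_mul_of_nonneg_right (by nlinarith) (sq_nonneg d)
    linarith
  · have h6 : ‖D.x (i + 1) 0 - D.x i 0‖ ≤ ‖D.x (i + 1) 0 - y‖ + ‖y - D.x i 0‖ :=
      norm_sub_le_norm_sub_add_norm_sub _ _ _
    rw [norm_sub_rev y, hyd] at h6
    linarith

/-- The iterates stay near `a`, because `‖x i - a‖ + (12 / c) d(x i, K)` does not increase. -/
theorem norm_sub_lt_of_isIteration (h : RegularNear K a κ β ε ρ) {c : ℝ}
    (hc : c = 1 / ((m + 1) * β ^ 2)) (hc1 : c ≤ 1) (hεc : 32 * ε * m ≤ c ^ 3 / 288)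
    (hstart : (1 + 12 / c) * ‖D.x 0 0 - a‖ < ρ / 10) (i : ℕ)
    (hD : ∀ i' < i, D.IsIteration K i') : ‖D.x i 0 - a‖ < ρ / 10 := by
  have hβ := h.beta_pos
  have hc0 : 0 < c := by rw [hc]; positivity
  have hd : ∀ x : Space n, 0 ≤ 12 / c * Metric.infDist x (⋂ l, K l) := fun x =>
    mul_nonneg (by positivity) Metric.infDist_nonneg
  -- `12 / c` balances a movement of `3 d` against a decrease of `d` by `c / 4 * d`
  suffices hs : ‖D.x i 0 - a‖ + 12 / c * Metric.infDist (D.x i 0) (⋂ l, K l) < ρ / 10 by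
    linarith [hd (D.x i 0)]
  induction i with
  | zero =>
    have h1 : Metric.infDist (D.x 0 0) (⋂ l, K l) ≤ ‖D.x 0 0 - a‖ := by
      rw [← dist_eq_norm]
      exact Metric.infDist_le_dist_of_mem h.mem
    have h2 : 12 / c * Metric.infDist (D.x 0 0) (⋂ l, K l) ≤ 12 / c * ‖D.x 0 0 - a‖ := by gcongr
    linarith
  | succ i ih =>
    have ih' := ih fun i' hi' => hD i' (hi'.trans i.lt_succ_self)
    obtain ⟨h1, h2⟩ := (hD i i.lt_succ_self).infDist_decrease h hc hc1 hεc
      (by linarith [hd (D.x i 0), norm_nonneg (D.x i 0 - a)])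
    have h3 : ‖D.x (i + 1) 0 - a‖ ≤ ‖D.x (i + 1) 0 - D.x i 0‖ + ‖D.x i 0 - a‖ :=
      norm_sub_le_norm_sub_add_norm_sub _ _ _
    have h4 := mul_le_mul_of_nonneg_left h1 (by positivity : 0 ≤ 12 / c)
    have h5 : 12 / c * ((1 - c / 4) * Metric.infDist (D.x i 0) (⋂ l, K l)) =
        12 / c * Metric.infDist (D.x i 0) (⋂ l, K l) -
          3 * Metric.infDist (D.x i 0) (⋂ l, K l) := by
      field_simp
      ring
    linarith

/-- The distance to the intersection decreases geometrically, so the iterates converge, and the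
distance to their limit is comparable to the distance to the intersection. Comparing with the limit
instead of the nearest point of the intersection then gives a contraction in each iteration. -/
theorem exists_convergesQLinearly (h : RegularNear K a κ β ε ρ) {c : ℝ}
    (hc : c = 1 / ((m + 1) * β ^ 2)) (hc1 : c ≤ 1) (hεc : 32 * ε * m ≤ c ^ 3 / 288)
    (hstart : (1 + 12 / c) * ‖D.x 0 0 - a‖ < ρ / 10) (hD : ∀ i, D.IsIteration K i) :
    ∃ xbar ∈ ⋂ l, K l, ConvergesQLinearly (fun i => D.x i 0) xbar (1 - c ^ 3 / 576) := by
  have hβ := h.beta_pos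
  have hc0 : 0 < c := by rw [hc]; positivity
  have hnear : ∀ i, ‖D.x i 0 - a‖ < ρ / 10 := fun i =>
    norm_sub_lt_of_isIteration h hc hc1 hεc hstart i fun i' _ => hD i'
  have hdec := fun i => (hD i).infDist_decrease h hc hc1 hεc
    (by linarith [hnear i, norm_nonneg (D.x i 0 - a)])
  set d : ℕ → ℝ := fun i => Metric.infDist (D.x i 0) (⋂ l, K l) with hd
  have hd0 : ∀ i, 0 ≤ d i := fun i => Metric.infDist_nonneg
  have hgeo : ∀ i k, d (i + k) ≤ d i * (1 - c / 4) ^ k := by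
    intro i k
    induction k with
    | zero => simp
    | succ k ih =>
      calc d (i + (k + 1)) ≤ (1 - c / 4) * d (i + k) := (hdec (i + k)).1
        _ ≤ (1 - c / 4) * (d i * (1 - c / 4) ^ k) :=
            mul_le_mul_of_nonneg_left ih (by linarith)
        _ = d i * (1 - c / 4) ^ (k + 1) := by ring
  have hmove : ∀ i k, dist (D.x (i + k) 0) (D.x (i + (k + 1)) 0) ≤
      3 * d i * (1 - c / 4) ^ k := by
    intro i k
    rw [dist_comm, dist_eq_norm]
    have h1 : ‖D.x (i + (k + 1)) 0 - D.x (i + k) 0‖ ≤ 3 * d (i + k) := (hdec (i + k)).2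
    linarith [hgeo i k]
  have hlt : 1 - c / 4 < 1 := by linarith
  have hcauchy : CauchySeq fun i => D.x i 0 :=
    cauchySeq_of_le_geometric (1 - c / 4) (3 * d 0) hlt fun k => by
      simpa using hmove 0 k
  obtain ⟨xbar, hlim⟩ := cauchySeq_tendsto_of_complete hcauchy
  have hdist : ∀ i, ‖D.x i 0 - xbar‖ ≤ 12 / c * d i := by
    intro i
    have hlim' : Tendsto (fun k => D.x (i + k) 0) atTop (𝓝 xbar) := by
      simpa only [add_comm i] using (tendsto_add_atTop_iff_nat i).2 hlim
    have h1 := dist_le_of_le_geometric_of_tendsto (1 - c / 4) (3 * d i) hlt (hmove i) hlim' 0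
    rw [add_zero, dist_eq_norm, pow_zero, mul_one] at h1
    refine h1.trans_eq ?_
    rw [sub_sub_cancel]
    field_simp
    ring
  have hclosed := isClosed_iInter h.isClosed
  have hd_lim : Tendsto d atTop (𝓝 0) := by
    refine squeeze_zero hd0 (fun k => by simpa using hgeo 0 k) ?_
    simpa using (tendsto_pow_atTop_nhds_zero_of_lt_one (by linarith) hlt).const_mul (d 0)
  have hxbar : xbar ∈ ⋂ l, K l := by
    rw [hclosed.mem_iff_infDist_zero ⟨a, h.mem⟩]
    exact tendsto_nhds_unique
      (((Metric.continuous_infDist_pt _).tendsto xbar).comp hlim) hd_lim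
  have hxa : ‖xbar - a‖ ≤ ρ / 10 :=
    le_of_tendsto (hlim.sub_const a).norm (Eventually.of_forall fun i => (hnear i).le)
  refine ⟨xbar, hxbar, hlim, fun i => ?_⟩
  have hR : ‖D.x i 0 - xbar‖ ≤ ‖D.x i 0 - a‖ + ‖a - xbar‖ :=
    norm_sub_le_norm_sub_add_norm_sub _ _ _
  rw [norm_sub_rev a] at hR
  have h1 := (hD i).norm_sub_sq_le h hxbar
    (by linarith [hnear i, norm_nonneg (D.x i 0 - a)])
  rw [← hc] at h1
  change _ ≤ _ - c * d i ^ 2 at h1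
  have hc3 : c ^ 3 ≤ 1 := pow_le_one₀ hc0.le hc1
  -- half of this decrease absorbs the error `32 * ε * m`, which is at most `c ^ 3 / 288`
  have h2 : c ^ 3 / 144 * ‖D.x i 0 - xbar‖ ^ 2 ≤ c * d i ^ 2 := by
    calc c ^ 3 / 144 * ‖D.x i 0 - xbar‖ ^ 2 ≤ c ^ 3 / 144 * (12 / c * d i) ^ 2 := by
          gcongr
          exact hdist i
      _ = c * d i ^ 2 := by
          field_simp
          norm_num
  refine (abs_le_of_sq_le_sq' ?_ (mul_nonneg (by linarith) (norm_nonneg _))).2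
  rw [mul_pow]
  have h3 : (1 + 32 * ε * m - c ^ 3 / 144) * ‖D.x i 0 - xbar‖ ^ 2 ≤
      (1 - c ^ 3 / 576) ^ 2 * ‖D.x i 0 - xbar‖ ^ 2 :=
    mul_le_mul_of_nonneg_right (by nlinarith [sq_nonneg (c ^ 3)]) (sq_nonneg _)
  linarith

end Trace

/-- Near a point of linearly regular intersection the regularity constants can be chosen with the
super-regularity error `ε` as small as the convergence proof needs; `κ` and `β` do not depend
on `ε`. -/
theorem LinearlyRegularIntersection.exists_regularNear {n m : ℕ} {K : Fin m → Set (Space n)}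
    {a : Space n} (h : LinearlyRegularIntersection K a) (hclosed : ∀ l, IsClosed (K l))
    (ha : a ∈ ⋂ l, K l) (hsuper : ∀ l, SuperRegularAt (K l) a) :
    ∃ κ β ε ρ c : ℝ, 0 < ρ ∧ RegularNear K a κ β ε ρ ∧ c = 1 / ((m + 1) * β ^ 2) ∧ 0 < c ∧
      c ≤ 1 ∧ 32 * ε * m ≤ c ^ 3 / 288 := by
  obtain ⟨κ, hκ, ρ₁, hρ₁, hT⟩ := h.exists_transversalNear
  obtain ⟨β₀, hβ₀, V, hV, hmetric⟩ := h.localMetricInequality hclosed ha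
  obtain ⟨ρ₂, hρ₂, hball⟩ := Metric.mem_nhds_iff.1 hV
  set β := max 1 β₀ with hβ
  have hβ1 : 1 ≤ β := le_max_left _ _
  set c : ℝ := 1 / ((m + 1) * β ^ 2) with hc
  have hc0 : 0 < c := by positivity
  have hc1 : c ≤ 1 := by
    rw [hc, div_le_one (by positivity)]
    nlinarith [one_le_pow₀ hβ1 (n := 2), (Nat.cast_nonneg m : (0 : ℝ) ≤ m)]
  set ε : ℝ := c ^ 3 / (288 * 32 * (m + 1)) with hε
  have hε0 : 0 < ε := by positivity
  have hεm : 32 * ε * m ≤ c ^ 3 / 288 := by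
    calc 32 * ε * m ≤ 32 * ε * (m + 1) := by gcongr; linarith
      _ = c ^ 3 / 288 := by rw [hε]; field_simp
  have hc3 : c ^ 3 ≤ 1 := pow_le_one₀ hc0.le hc1
  choose σ hσ hS using fun l => (hsuper l).exists_superRegularNear (mul_pos hκ hε0)
  obtain ⟨ρ₃, hρ₃, hρσ⟩ : ∃ ρ₃ : ℝ, 0 < ρ₃ ∧ ∀ l, ρ₃ ≤ σ l := by
    obtain ⟨r, hr, hrσ⟩ := Pi.exists_forall_pos_add_lt
      (x := fun _ : Fin m => (0 : ℝ)) (y := σ) (fun l => hσ l)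
    exact ⟨r, hr, fun l => by simpa using (hrσ l).le⟩
  refine ⟨κ, β, ε, min ρ₁ (min ρ₂ ρ₃), c, by positivity, ?_, rfl, hc0, hc1, hεm⟩
  refine
    { isClosed := hclosed
      mem := ha
      kappa_pos := hκ
      beta_pos := by linarith
      eps_pos := hε0
      eps_mul_le := by linarith
      transversal := fun p v hp hpa hv =>
        hT p v hp (fun l => (hpa l).trans_le (min_le_left _ _)) hv
      superRegular := fun l z hz y hy hza hya v hv => ?_
      metric := fun x hx => ?_ }
  · have h1 : min ρ₁ (min ρ₂ ρ₃) ≤ σ l :=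
      (min_le_right _ _).trans ((min_le_right _ _).trans (hρσ l))
    exact hS l z hz y hy (hza.trans_le h1) (hya.trans_le h1) v hv
  · have h1 : x ∈ V := hball (by
      rw [Metric.mem_ball, dist_eq_norm]
      exact hx.trans_le ((min_le_right _ _).trans (min_le_left _ _)))
    refine (hmetric x h1).trans (mul_le_mul_of_nonneg_right (le_max_right _ _) ?_)
    exact Real.iSup_nonneg fun _ => Metric.infDist_nonneg

end SetIntersection

theorem mainTheorem1 {n m : ℕ} (K : Fin m → Set (SetIntersection.Space n))
    (xs : SetIntersection.Space n)
    (hclosed : ∀ l, IsClosed (K l))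
    (hxs : xs ∈ ⋂ l, K l)
    (hsuper : ∀ l, SetIntersection.SuperRegularAt (K l) xs) :
    (0 < SetIntersection.eta K xs ↔ SetIntersection.LinearlyRegularIntersection K xs) ∧
    (SetIntersection.LinearlyRegularIntersection K xs →
      SetIntersection.LocalMetricInequality K xs) ∧
    (0 < SetIntersection.eta K xs →
      ∃ q : ℝ, 0 < q ∧ q < 1 ∧ ∃ U ∈ 𝓝 xs, ∀ x₀ ∈ U,
        -- the algorithm never breaks down
        (∀ (D : SetIntersection.Trace n m) (i : ℕ) (j : Fin m),
          D.IsRunUntil K x₀ i j → (D.F K i j).Nonempty) ∧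
        -- every run converges Q-linearly to a point of the intersection
        (∀ D : SetIntersection.Trace n m, D.IsRun K x₀ →
          ∃ xbar ∈ ⋂ l, K l,
            SetIntersection.ConvergesQLinearly (fun i => D.x i 0) xbar q)) := by
  have hLRI := SetIntersection.eta_pos_iff hxs
  refine ⟨hLRI, fun h => h.localMetricInequality hclosed hxs, fun hη => ?_⟩
  obtain ⟨κ, β, ε, ρ, c, hρ, hreg, hc, hc0, hc1, hεc⟩ :=
    (hLRI.1 hη).exists_regularNear hclosed hxs hsuper
  have hc3 : c ^ 3 ≤ 1 := pow_le_one₀ hc0.le hc1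
  have hc3' : 0 < c ^ 3 := by positivity
  refine ⟨1 - c ^ 3 / 576, by linarith, by linarith,
    Metric.ball xs (ρ / 10 / (1 + 12 / c)), Metric.ball_mem_nhds _ (by positivity),
    fun x₀ hx₀ => ?_⟩
  rw [Metric.mem_ball, dist_eq_norm, lt_div_iff₀' (by positivity)] at hx₀
  refine ⟨fun D i j hD => ?_, fun D hD => ?_⟩
  · have hnear := SetIntersection.Trace.norm_sub_lt_of_isIteration (D := D) hreg hc hc1 hεc
      (by rwa [hD.start]) i fun i' hi' =>
        ⟨hD.covers i' hi'.le, fun j' => hD.admissible i' j' (Or.inl hi'),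
          fun j' => hD.solves i' j' (Or.inl hi'), hD.next i' hi'⟩
    exact SetIntersection.Trace.nonempty_F hreg
      (by linarith [norm_nonneg (D.x i 0 - xs)])
      (fun k hk => hD.admissible i k (Or.inr ⟨rfl, hk⟩))
      (fun k hk => hD.solves i k (Or.inr ⟨rfl, hk⟩))
  · exact SetIntersection.Trace.exists_convergesQLinearly hreg hc hc1 hεc
      (by rwa [hD.start]) fun i => ⟨hD.covers i, hD.admissible i, hD.solves i, hD.next i⟩
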